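/- Let $\alpha\in(0,2]$, $H\in(0,1)$, and let $(X_t)_{t\in\mathbb R}$ be a linear fractional stable motion, $X_t=\int_{\mathbb R}\left[(t-s)_+^{H-1/\alpha}-(-s)_+^{H-1/\alpha}\right]dL_\alpha(s)$, where $x_+^{p}=x^p$ for $x>0$ and $x_+^{p}=0$ for $x\le 0$ and where $L_\alpha$ is a two-sided symmetric $\alpha$-stable ($S\alpha S$) Lévy motion: $L_\alpha(0)=0$, the increments are independent, and $L_\alpha(u)-L_\alpha(s)$ is $S\alpha S$ with scale parameter $|u-s|^{1/\alpha}$. (A variable is $S\alpha S$ with scale $\gamma\ge 0$ if its characteristic function is $\theta\mapsto e^{-\gamma^\alpha|\theta|^\alpha}$. The integral of $f\in L^\alpha(\mathbb R)$ is the limit in probability of the integrals of step functions converging to $f$ in $L^\alpha(\mathbb R)$.) Put $K_{\alpha,H}=\left(\int_{\mathbb R}\left|(1-s)_+^{H-1/\alpha}-(-s)_+^{H-1/\alpha}\right|^\alpha ds\right)^{1/\alpha}$. For random variables $Y,W$, the codifference is $\mathrm{CD}(Y,W)=-\ln\Phi_Y(1)-\ln\Phi_W(-1)+\ln\Phi_{Y-W}(1)$,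 where $\Phi$ denotes the characteristic function. Let $t\in\mathbb N=\{0,1,2,\dots\}$ and $d\ge 1$. Suppose that there are independent $S\alpha S$ variables $Z_0,\dots,Z_{d-1}$ of scale parameter $1$ (possibly on another probability space) and reals $a_{t,i,j}$, $0\le i,j\le d-1$, with $a_{t,i,j}=0$ for $j>i$, such that the variables $\mathcal T X_{t+i}=\sum_{j=0}^i a_{t,i,j}Z_j$ satisfy $\mathrm{CD}(\mathcal TX_{t+i},\mathcal TX_{t+i'})=\mathrm{CD}(X_{t+i},X_{t+i'})$ for all $0\le i,i'\le d-1$. Suppose moreover that the coefficients are admissible, that is: (a) $a_{t,i,j}>0$ for $0\le j\le i\le d-1$; (b) for all $0\le j\le i<i'\le d-1$: $a_{t,i',j}>a_{t,i,j}$ if $H>1/\alpha$, $a_{t,i',j}<a_{t,i,j}$ if $H<1/\alpha$, and $a_{t,i',j}=a_{t,i,j}$ if $H=1/\alpha$. Then: 1. The coefficients solve the system of $d(d+1)/2$ nonlinear equations $$(\mathcal E_{i,i})\quad |a_{t,i,i}|^\alpha=K_{\alpha,H}^\alpha|t+i|^{\alpha H}-\sum_{j=0}^{i-1}|a_{t,i,j}|^\alpha,\qquad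 0\le i\le d-1,$$ $$(\mathcal E_{i',i})\quad f_{t,i',i}(a_{t,i',i})=K_{\alpha,H}^\alpha\left(|t+i'|^{\alpha H}-|i'-i|^{\alpha H}\right)-\sum_{j=0}^{i-1}\left(|a_{t,i',j}|^\alpha-|a_{t,i',j}-a_{t,i,j}|^\alpha\right),\qquad 0\le i<i'\le d-1,$$ where $f_{t,i',i}(z)=|z|^\alpha-|z-a_{t,i,i}|^\alpha$. 2. The coefficients are unique: $(a_{t,i,j})$ is the only admissible lower-triangular array that solves this system, and any other decomposition of the above form, with admissible coefficients and on any probability space, has the same coefficients. 3. If $H=1/\alpha$, then $a_{t,i,j}=t^{\frac1\alpha\mathbf 1_{j=0}}\mathbf 1_{i\ge j}$ for all $0\le i,j\le d-1$. -/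

import Mathlib

open MeasureTheory ProbabilityTheory Filter Topology

noncomputable section

/-- `Y` is a symmetric `α`-stable random variable with scale parameter `γ` under `P`: its
characteristic function is `θ ↦ exp (-γ ^ α * |θ| ^ α)`. -/
def IsSaS {Ω : Type*} [MeasurableSpace Ω] (α γ : ℝ) (Y : Ω → ℝ) (P : Measure Ω) : Prop :=
  AEMeasurable Y P ∧
    ∀ θ : ℝ, charFun (P.map Y) θ = ((Real.exp (-(γ ^ α * |θ| ^ α)) : ℝ) : ℂ)

/-- The codifference `-ln Φ_Y(1) - ln Φ_W(-1) + ln Φ_{Y - W}(1)` of two random variables. -/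
def codifference {Ω : Type*} [MeasurableSpace Ω] (P : Measure Ω) (Y W : Ω → ℝ) : ℂ :=
  -Complex.log (charFun (P.map Y) 1) - Complex.log (charFun (P.map W) (-1))
    + Complex.log (charFun (P.map (fun ω => Y ω - W ω)) 1)

/-- A two-sided symmetric `α`-stable Lévy motion: it starts from `0`, has independent
increments, and its increment over `[s, u]` is symmetric `α`-stable with scale parameter
`|u - s| ^ (1 / α)`. -/
structure IsSaSLevyMotion {Ω : Type*} [MeasurableSpace Ω] (α : ℝ) (L : ℝ → Ω → ℝ)
    (P : Measure Ω) : Prop where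
  zero : ∀ᵐ ω ∂P, L 0 ω = 0
  indep : HasIndepIncrements L P
  increments : ∀ s u : ℝ, s ≤ u →
    IsSaS α (|u - s| ^ (1 / α)) (fun ω => L u ω - L s ω) P

/-- One term `coeff * 1_{(left, right]}` of a step function on the line. -/
structure StepTerm where
  coeff : ℝ
  left : ℝ
  right : ℝ
  left_le_right : left ≤ right

/-- The step function `s ↦ ∑ coeff * 1_{(left, right]}(s)`. -/
def stepFun (S : List StepTerm) (s : ℝ) : ℝ :=
  (S.map fun T => (Set.Ioc T.left T.right).indicator (fun _ => T.coeff) s).sum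

/-- The integral `∑ coeff * (L(right) - L(left))` of a step function against `L`. -/
def stepIntegral {Ω : Type*} (L : ℝ → Ω → ℝ) (S : List StepTerm) (ω : Ω) : ℝ :=
  (S.map fun T => T.coeff * (L T.right ω - L T.left ω)).sum

/-- `Y` is (a version of) the stochastic integral `∫ f dL` of a deterministic function `f` against
the symmetric `α`-stable Lévy motion `L`: the limit in probability of the integrals of step
functions which converge to `f` in `L^α(ℝ, ds)`. -/
def IsStableIntegral {Ω : Type*} [MeasurableSpace Ω] (α : ℝ) (P : Measure Ω) (L : ℝ → Ω → ℝ)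
    (f : ℝ → ℝ) (Y : Ω → ℝ) : Prop :=
  Measurable f ∧ ∃ S : ℕ → List StepTerm,
    Tendsto (fun n => eLpNorm (fun s => stepFun (S n) s - f s) (ENNReal.ofReal α) volume)
      atTop (𝓝 0) ∧
    TendstoInMeasure P (fun n => stepIntegral L (S n)) atTop Y

/-- `x_+ ^ a`, equal to `x ^ a` for `x > 0` and to `0` for `x ≤ 0` (also when `a ≤ 0`). -/
def posPartPow (x a : ℝ) : ℝ := if 0 < x then x ^ a else 0

/-- The kernel `s ↦ (t - s)_+ ^ (H - 1 / α) - (-s)_+ ^ (H - 1 / α)`. -/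
def lfsmKernel (α H t s : ℝ) : ℝ :=
  posPartPow (t - s) (H - 1 / α) - posPartPow (-s) (H - 1 / α)

/-- `X` is a linear fractional stable motion with stability parameter `α` and Hurst exponent
`H`. -/
def IsLFSM {Ω : Type*} [MeasurableSpace Ω] (α H : ℝ) (P : Measure Ω) (X : ℝ → Ω → ℝ) : Prop :=
  ∃ L : ℝ → Ω → ℝ, IsSaSLevyMotion α L P ∧
    ∀ t : ℝ, IsStableIntegral α P L (lfsmKernel α H t) (X t)

/-- The scale constant
`K_{α,H} = (∫ |(1 - s)_+ ^ (H - 1 / α) - (-s)_+ ^ (H - 1 / α)| ^ α ds) ^ (1 / α)`. -/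
def lfsmScale (α H : ℝ) : ℝ := (∫ s : ℝ, |lfsmKernel α H 1 s| ^ α) ^ (1 / α)

/-- The random variable `∑_{j ≤ i} a_{i,j} Z_j`. -/
def lowerCombination {Ω : Type*} {d : ℕ} (a : Fin d → Fin d → ℝ) (Z : Fin d → Ω → ℝ)
    (i : Fin d) (ω : Ω) : ℝ :=
  ∑ j ∈ Finset.Iic i, a i j * Z j ω

/-- `(∑_{j ≤ i} a_{i,j} Z_j)_{0 ≤ i < d}` is a lower-triangular decomposition, in independent
standard symmetric `α`-stable variables `Z_j`, with the same codifference matrix as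
`(X_t, …, X_{t+d-1})`. The `Z_j` may live on another probability space than `X`. -/
structure IsCodiffDecomposition {Ω Ω' : Type*} [MeasurableSpace Ω] [MeasurableSpace Ω']
    (α : ℝ) (P : Measure Ω) (X : ℝ → Ω → ℝ) (t d : ℕ) (P' : Measure Ω')
    (Z : Fin d → Ω' → ℝ) (a : Fin d → Fin d → ℝ) : Prop where
  stable : ∀ j, IsSaS α 1 (Z j) P'
  indep : iIndepFun Z P'
  lower : ∀ i j, i < j → a i j = 0
  codiff_eq : ∀ i i' : Fin d,
    codifference P' (lowerCombination a Z i) (lowerCombination a Z i') =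
      codifference P (X ((t : ℝ) + (i : ℕ))) (X ((t : ℝ) + (i' : ℕ)))

/-- The sign and monotonicity conditions on the coefficients. -/
structure IsAdmissible (α H : ℝ) {d : ℕ} (a : Fin d → Fin d → ℝ) : Prop where
  pos : ∀ i j, j ≤ i → 0 < a i j
  increasing : 1 / α < H → ∀ j i i', j ≤ i → i < i' → a i j < a i' j
  decreasing : H < 1 / α → ∀ j i i', j ≤ i → i < i' → a i' j < a i j
  constant : H = 1 / α → ∀ j i i', j ≤ i → i < i' → a i' j = a i j

/-- The function `f_{t,i',i}(z) = |z| ^ α - |z - a_{t,i,i}| ^ α`. -/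
def offDiagFun (α : ℝ) {d : ℕ} (a : Fin d → Fin d → ℝ) (i : Fin d) (z : ℝ) : ℝ :=
  |z| ^ α - |z - a i i| ^ α

/-- The system of `d (d + 1) / 2` nonlinear equations `(𝓔_{i,i})`, `0 ≤ i < d`, and
`(𝓔_{i',i})`, `0 ≤ i < i' < d`. -/
structure SolvesSystem (α H : ℝ) (t : ℕ) {d : ℕ} (a : Fin d → Fin d → ℝ) : Prop where
  diag : ∀ i : Fin d,
    |a i i| ^ α = lfsmScale α H ^ α * |(t : ℝ) + (i : ℕ)| ^ (α * H)
      - ∑ j ∈ Finset.Iio i, |a i j| ^ α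
  offDiag : ∀ i i' : Fin d, i < i' →
    offDiagFun α a i (a i' i) =
      lfsmScale α H ^ α *
          (|(t : ℝ) + (i' : ℕ)| ^ (α * H) - |((i' : ℕ) : ℝ) - (i : ℕ)| ^ (α * H))
        - ∑ j ∈ Finset.Iio i, (|a i' j| ^ α - |a i' j - a i j| ^ α)

end

/-! A stable integral `∫ f dL` has characteristic function `exp (-‖f‖^α |θ|^α)`, with `‖f‖^α = ∫
|f|^α`: for step functions this is independence of increments, and it survives the limit in
probability. Hence `CD(∫ f dL, ∫ g dL) = ‖f‖^α + ‖g‖^α - ‖f - g‖^α`, and combinations of the `Z_j`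
obey the same formula with sums over `j`. Translating and rescaling the kernel gives `‖k_t - k_s‖^α
= K^α |t - s|^(αH)`. Equating the two codifferences yields the system, since triangularity kills the
terms with `j > i` and isolates `j = i`.

Uniqueness goes column by column. Once the earlier columns are known, the diagonal equation fixes
`a_jj > 0`, and the other equations fix the value of `z ↦ |z|^α - |z - a_jj|^α` at `a_ij`.
Admissibility puts `a_ij` in `(0, a_jj)` or in `(a_jj, ∞)`, where this function is strictly
increasing, or makes it equal to `a_jj`. On the unbounded interval this needs `α > 1`, which `1/α <
H < 1` provides. If `H = 1/α`, columns are constant and differencing consecutive diagonal equations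
gives the closed form. -/

/-! ### Step functions over a common partition -/

/-- A finite set of reals is contained in an initial segment of a monotone sequence. -/
theorem exists_monotone_seq_mem (F : Finset ℝ) :
    ∃ (x : ℕ → ℝ) (n : ℕ), Monotone x ∧ ∀ y ∈ F, ∃ p ≤ n, x p = y := by
  obtain rfl | hF := F.eq_empty_or_nonempty
  · exact ⟨fun _ => 0, 0, monotone_const, by simp⟩
  obtain ⟨m, hm⟩ : ∃ m, F.card = m + 1 := ⟨F.card - 1, by have := hF.card_pos; omega⟩
  -- The increasing enumeration of `F`, frozen at its last element.
  refine ⟨fun k => F.orderEmbOfFin hm ⟨min k m, by omega⟩, m, ?_, ?_⟩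
  · intro i j hij
    refine (F.orderEmbOfFin hm).monotone ?_
    simp only [Fin.mk_le_mk]
    omega
  · intro y hy
    have : y ∈ Set.range (F.orderEmbOfFin hm) := by
      rw [Finset.range_orderEmbOfFin]; exact hy
    obtain ⟨k, rfl⟩ := this
    refine ⟨k, by omega, ?_⟩
    exact congrArg (F.orderEmbOfFin hm) (Fin.ext (show min (k : ℕ) m = k by omega))

/-- Composing `g` with the clamp to `[x p, x q]` leaves the increments inside the interval unchanged
and kills the others; the resulting sum telescopes. -/
theorem sub_eq_sum_indicator_mul_increments {x : ℕ → ℝ} (hx : Monotone x) {n p q : ℕ}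
    (hq : q ≤ n) (hpq : x p ≤ x q) (g : ℝ → ℝ) :
    g (x q) - g (x p) = ∑ k ∈ Finset.range n,
      (Set.Ioc (x p) (x q)).indicator (fun _ => (1 : ℝ)) (x (k + 1)) *
        (g (x (k + 1)) - g (x k)) := by
  have key : ∀ k ∈ Finset.range n,
      (Set.Ioc (x p) (x q)).indicator (fun _ => (1 : ℝ)) (x (k + 1)) *
        (g (x (k + 1)) - g (x k)) =
      g (min (max (x (k + 1)) (x p)) (x q)) - g (min (max (x k) (x p)) (x q)) := by
    intro k _
    have hk : x k ≤ x (k + 1) := hx (Nat.le_succ k)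
    rcases le_or_gt (x (k + 1)) (x p) with h1 | h1
    · rw [Set.indicator_of_notMem (by simp [h1]), max_eq_right h1, max_eq_right (hk.trans h1)]
      simp
    have hpk : x p ≤ x k := hx (by
      by_contra h
      exact absurd (hx (show k + 1 ≤ p by omega)) (not_le.2 h1))
    rw [max_eq_left h1.le, max_eq_left hpk]
    rcases le_or_gt (x (k + 1)) (x q) with h2 | h2
    · rw [Set.indicator_of_mem (by exact ⟨h1, h2⟩), min_eq_left h2, min_eq_left (hk.trans h2),
        one_mul]
    · have hqk : x q ≤ x k := hx (by
        by_contra h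
        exact absurd (hx (show k + 1 ≤ q by omega)) (not_le.2 h2))
      rw [Set.indicator_of_notMem (by simp [h2]), min_eq_right h2.le, min_eq_right hqk]
      simp
  rw [Finset.sum_congr rfl key,
    Finset.sum_range_sub (fun k => g (min (max (x k) (x p)) (x q)))]
  have h0 : x 0 ≤ x p := hx (Nat.zero_le _)
  have hn : x q ≤ x n := hx hq
  rw [max_eq_left (hpq.trans hn), min_eq_right hn, max_eq_right h0, min_eq_left hpq]

/-- The increments of a step function's terms, rewritten over a common partition. -/
theorem exists_partition (S : List StepTerm) :
    ∃ (x : ℕ → ℝ) (n : ℕ), Monotone x ∧ ∀ g : ℝ → ℝ,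
      (S.map fun T => T.coeff * (g T.right - g T.left)).sum =
        ∑ k ∈ Finset.range n, stepFun S (x (k + 1)) * (g (x (k + 1)) - g (x k)) := by
  obtain ⟨x, n, hx, hS⟩ := exists_monotone_seq_mem
    ((S.map StepTerm.left).toFinset ∪ (S.map StepTerm.right).toFinset)
  refine ⟨x, n, hx, fun g => ?_⟩
  have hS' : ∀ T ∈ S, (∃ p ≤ n, x p = T.left) ∧ ∃ q ≤ n, x q = T.right := fun T hT =>
    ⟨hS _ (Finset.mem_union_left _ (by simpa using ⟨T, hT, rfl⟩)),
      hS _ (Finset.mem_union_right _ (by simpa using ⟨T, hT, rfl⟩))⟩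
  -- `hS` depends on `S`; without it the induction runs with `x` and `n` fixed.
  clear hS
  induction S with
  | nil => simp [stepFun]
  | cons T S ih =>
    have ih' := ih fun T hT => hS' T (List.mem_cons_of_mem _ hT)
    obtain ⟨⟨p, -, hpl⟩, ⟨q, hq, hqr⟩⟩ := hS' T List.mem_cons_self
    have h := sub_eq_sum_indicator_mul_increments hx hq
      (by rw [hpl, hqr]; exact T.left_le_right) g
    rw [hpl, hqr] at h
    have e2 : ∀ s, stepFun (T :: S) s
        = T.coeff * (Set.Ioc T.left T.right).indicator (fun _ => (1 : ℝ)) s + stepFun S s := by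
      intro s
      by_cases hs : s ∈ Set.Ioc T.left T.right <;> simp [stepFun, hs]
    rw [List.map_cons, List.sum_cons, ih', h, Finset.mul_sum, ← Finset.sum_add_distrib]
    refine Finset.sum_congr rfl fun k _ => ?_
    rw [e2]
    ring

/-- Evaluation at `s` is integration against the path `u ↦ 1_{s ≤ u}`, so identities valid for every
integrator, such as `exists_partition`, also apply to step functions. -/
theorem stepFun_eq_stepIntegral (S : List StepTerm) (s : ℝ) :
    stepFun S s = stepIntegral (fun u r => if r ≤ u then (1 : ℝ) else 0) S s := by
  unfold stepFun stepIntegral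
  congr 1
  refine List.map_congr_left fun T _ => ?_
  have := T.left_le_right
  by_cases h1 : s ≤ T.left
  · simp [h1, h1.trans this]
  · by_cases h2 : s ≤ T.right <;> simp [h1, h2]

theorem measurable_stepFun (S : List StepTerm) : Measurable (stepFun S) := by
  induction S with
  | nil => exact measurable_const
  | cons T S ih =>
    have : stepFun (T :: S) = fun s =>
        (Set.Ioc T.left T.right).indicator (fun _ => T.coeff) s + stepFun S s := by
      funext s; simp [stepFun]
    rw [this]
    exact (measurable_const.indicator measurableSet_Ioc).add ih

/-! ### Characteristic functions of step integrals -/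

/-- The `α`-th power of the `L^α` (quasi-)norm. -/
noncomputable def absMoment (α : ℝ) (f : ℝ → ℝ) : ENNReal := ∫⁻ s, ‖f s‖ₑ ^ α

/-- The cells are disjoint, so at each point at most one term survives and the power passes inside
the sum. -/
theorem absMoment_sum_indicator_partition {α : ℝ} (hα : 0 < α) {x : ℕ → ℝ} (hx : Monotone x)
    (c : ℕ → ℝ) (n : ℕ) :
    absMoment α (fun s => ∑ k ∈ Finset.range n,
        c k * (Set.Ioc (x k) (x (k + 1))).indicator (fun _ => (1 : ℝ)) s) =
      ENNReal.ofReal (∑ k ∈ Finset.range n, |c k| ^ α * (x (k + 1) - x k)) := by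
  have hpt : ∀ s, ‖∑ k ∈ Finset.range n,
        c k * (Set.Ioc (x k) (x (k + 1))).indicator (fun _ => (1 : ℝ)) s‖ₑ ^ α =
      ∑ k ∈ Finset.range n,
        (Set.Ioc (x k) (x (k + 1))).indicator (fun _ => ENNReal.ofReal (|c k| ^ α)) s := by
    intro s
    by_cases h : ∃ k ∈ Finset.range n, s ∈ Set.Ioc (x k) (x (k + 1))
    · obtain ⟨k, hk, hs⟩ := h
      have hne : ∀ j ∈ Finset.range n, j ≠ k → s ∉ Set.Ioc (x j) (x (j + 1)) := by
        intro j _ hjk hj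
        exact Set.disjoint_left.1 (hx.pairwise_disjoint_on_Ioc_succ hjk) hj hs
      rw [Finset.sum_eq_single_of_mem k hk (fun j hj hjk => by
          rw [Set.indicator_of_notMem (hne j hj hjk), mul_zero]),
        Finset.sum_eq_single_of_mem k hk (fun j hj hjk => by
          rw [Set.indicator_of_notMem (hne j hj hjk)]),
        Set.indicator_of_mem hs, Set.indicator_of_mem hs, mul_one,
        Real.enorm_eq_ofReal_abs, ENNReal.ofReal_rpow_of_nonneg (abs_nonneg _) hα.le]
    · push Not at h
      rw [Finset.sum_eq_zero (fun k hk => by rw [Set.indicator_of_notMem (h k hk), mul_zero]),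
        Finset.sum_eq_zero (fun k hk => by rw [Set.indicator_of_notMem (h k hk)])]
      simp [hα]
  unfold absMoment
  simp_rw [hpt]
  rw [lintegral_finsetSum _ fun k _ => measurable_const.indicator measurableSet_Ioc,
    ENNReal.ofReal_sum_of_nonneg fun k _ =>
      mul_nonneg (by positivity) (sub_nonneg.2 (hx (Nat.le_succ k)))]
  refine Finset.sum_congr rfl fun k _ => ?_
  rw [lintegral_indicator_const measurableSet_Ioc, Real.volume_Ioc,
    ENNReal.ofReal_mul (by positivity)]

theorem charFun_sum_mul {ι Ω : Type*} [MeasurableSpace Ω] {P : Measure Ω}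
    {α : ℝ} {Z : ι → Ω → ℝ} {γ : ι → ℝ} (hZ : ∀ i, IsSaS α (γ i) (Z i) P)
    (hind : iIndepFun Z P) (s : Finset ι) (c : ι → ℝ) (θ : ℝ) :
    charFun (P.map fun ω => ∑ i ∈ s, c i * Z i ω) θ =
      ((Real.exp (-((∑ i ∈ s, |c i| ^ α * γ i ^ α) * |θ| ^ α)) : ℝ) : ℂ) := by
  have hind' : iIndepFun (fun i ω => c i * Z i ω) P :=
    hind.comp (fun i y => c i * y) fun i => measurable_const_mul (c i)
  rw [iIndepFun.charFun_map_fun_finsetSum_eq_prod (fun i _ => (hZ i).1.const_mul (c i))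
      (iIndepFun.precomp (g := fun i : s => (i : ι)) Subtype.val_injective hind'),
    Finset.prod_apply]
  have : ∀ i ∈ s, charFun (P.map fun ω => c i * Z i ω) θ =
      ((Real.exp (-(|c i| ^ α * γ i ^ α * |θ| ^ α)) : ℝ) : ℂ) := by
    intro i _
    rw [charFun_map_mul_comp (hZ i).1, (hZ i).2, abs_mul, Real.mul_rpow (abs_nonneg _) (abs_nonneg _)]
    congr 3
    ring
  rw [Finset.prod_congr rfl this, ← Complex.ofReal_prod, ← Real.exp_sum, Finset.sum_neg_distrib,
    Finset.sum_mul]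

theorem aemeasurable_stepIntegral {Ω : Type*} [MeasurableSpace Ω] {P : Measure Ω} {α : ℝ}
    {L : ℝ → Ω → ℝ} (hL : IsSaSLevyMotion α L P) (S : List StepTerm) :
    AEMeasurable (stepIntegral L S) P := by
  obtain ⟨x, n, hx, h⟩ := exists_partition S
  rw [show stepIntegral L S = fun ω => _ from funext fun ω => h fun u => L u ω]
  exact Finset.aemeasurable_fun_sum _ fun k _ =>
    (hL.increments _ _ (hx (Nat.le_succ k))).1.const_mul _

theorem charFun_stepIntegral {Ω : Type*} [MeasurableSpace Ω] {P : Measure Ω}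
    {α : ℝ} (hα : 0 < α) {L : ℝ → Ω → ℝ} (hL : IsSaSLevyMotion α L P) (S : List StepTerm) :
    absMoment α (stepFun S) ≠ ⊤ ∧ ∀ θ : ℝ, charFun (P.map (stepIntegral L S)) θ =
      ((Real.exp (-((absMoment α (stepFun S)).toReal * |θ| ^ α)) : ℝ) : ℂ) := by
  obtain ⟨x, n, hx, h⟩ := exists_partition S
  have hf : stepFun S = fun s => ∑ k ∈ Finset.range n,
      stepFun S (x (k + 1)) * (Set.Ioc (x k) (x (k + 1))).indicator (fun _ => (1 : ℝ)) s := by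
    funext s
    rw [stepFun_eq_stepIntegral, stepIntegral, h fun u => if s ≤ u then (1 : ℝ) else 0]
    refine Finset.sum_congr rfl fun k _ => ?_
    have hk := hx (Nat.le_succ k)
    by_cases h1 : s ≤ x k
    · simp [h1, h1.trans hk]
    · by_cases h2 : s ≤ x (k + 1) <;> simp [h1, h2, not_le.1 h1]
  have hm : absMoment α (stepFun S) = ENNReal.ofReal
      (∑ k ∈ Finset.range n, |stepFun S (x (k + 1))| ^ α * (x (k + 1) - x k)) := by
    conv_lhs => rw [hf]
    exact absMoment_sum_indicator_partition hα hx (fun k => stepFun S (x (k + 1))) n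
  refine ⟨by rw [hm]; exact ENNReal.ofReal_ne_top, fun θ => ?_⟩
  have hx' : ∀ k, 0 ≤ x (k + 1) - x k := fun k => sub_nonneg.2 (hx (Nat.le_succ k))
  rw [hm, ENNReal.toReal_ofReal (Finset.sum_nonneg fun k _ => mul_nonneg (by positivity) (hx' k)),
    show stepIntegral L S = fun ω => _ from funext fun ω => h fun u => L u ω,
    charFun_sum_mul (fun k => hL.increments _ _ (hx (Nat.le_succ k))) (hL.indep.nat hx)]
  congr 5
  funext k
  rw [← Real.rpow_mul (abs_nonneg _), one_div_mul_cancel hα.ne', Real.rpow_one,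
    abs_of_nonneg (hx' k)]

/-! ### Passage to the limit: stable integrals -/

/-- Minkowski with `β = 1/α` if `α ≥ 1`; subadditivity of `x ↦ x^α` with `β = 1` if `α ≤ 1`. One
exponent lets later limits treat both ranges together. -/
theorem exists_absMoment_rpow_subadditive {α : ℝ} (hα : 0 < α) :
    ∃ β : ℝ, 0 < β ∧ ∀ f g : ℝ → ℝ, Measurable f → Measurable g →
      absMoment α (fun s => f s + g s) ^ β ≤ absMoment α f ^ β + absMoment α g ^ β := by
  rcases le_total 1 α with h | h
  · refine ⟨1 / α, by positivity, fun f g hf hg => ?_⟩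
    refine le_trans ?_ (ENNReal.lintegral_Lp_add_le hf.enorm.aemeasurable hg.enorm.aemeasurable h)
    refine ENNReal.rpow_le_rpow (lintegral_mono fun s => ?_) (by positivity)
    exact ENNReal.rpow_le_rpow (enorm_add_le _ _) hα.le
  · refine ⟨1, one_pos, fun f g hf hg => ?_⟩
    simp only [ENNReal.rpow_one, absMoment]
    rw [← lintegral_add_left (hf.enorm.pow_const α)]
    refine lintegral_mono fun s => ?_
    exact (ENNReal.rpow_le_rpow (enorm_add_le _ _) hα.le).trans
      (ENNReal.rpow_add_le_add_rpow _ _ hα.le h)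

theorem absMoment_neg (α : ℝ) (f : ℝ → ℝ) : absMoment α (fun s => -f s) = absMoment α f := by
  simp [absMoment]

theorem tendsto_rpow_zero_iff {u : ℕ → ENNReal} {β : ℝ} (hβ : 0 < β) :
    Tendsto (fun n => u n ^ β) atTop (𝓝 0) ↔ Tendsto u atTop (𝓝 0) := by
  constructor
  · intro h
    have := (ENNReal.continuous_rpow_const (y := β⁻¹)).continuousAt.tendsto.comp h
    simpa [Function.comp_def, ← ENNReal.rpow_mul, hβ.ne', hβ] using this
  · intro h
    have := (ENNReal.continuous_rpow_const (y := β)).continuousAt.tendsto.comp h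
    simpa [Function.comp_def, hβ] using this

theorem eLpNorm_eq_absMoment {α : ℝ} (hα : 0 < α) (f : ℝ → ℝ) :
    eLpNorm f (ENNReal.ofReal α) volume = absMoment α f ^ (1 / α) := by
  rw [eLpNorm_eq_lintegral_rpow_enorm_toReal (by simpa using hα) ENNReal.ofReal_ne_top,
    ENNReal.toReal_ofReal hα.le]
  rfl

theorem tendsto_eLpNorm_iff_absMoment {α : ℝ} (hα : 0 < α) (u : ℕ → ℝ → ℝ) :
    Tendsto (fun n => eLpNorm (u n) (ENNReal.ofReal α) volume) atTop (𝓝 0) ↔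
      Tendsto (fun n => absMoment α (u n)) atTop (𝓝 0) := by
  simp_rw [eLpNorm_eq_absMoment hα]
  exact tendsto_rpow_zero_iff (by positivity)

theorem tendsto_toReal_absMoment {α : ℝ} (hα : 0 < α) {u : ℕ → ℝ → ℝ} {f : ℝ → ℝ}
    (hu : ∀ n, Measurable (u n)) (hf : Measurable f) (hfin : ∀ n, absMoment α (u n) ≠ ⊤)
    (h : Tendsto (fun n => absMoment α fun s => u n s - f s) atTop (𝓝 0)) :
    Tendsto (fun n => (absMoment α (u n)).toReal) atTop (𝓝 (absMoment α f).toReal) := by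
  obtain ⟨β, hβ, hadd⟩ := exists_absMoment_rpow_subadditive hα
  have h' := (tendsto_rpow_zero_iff hβ).2 h
  have h1 : ∀ n, absMoment α (u n) ^ β ≤
      absMoment α f ^ β + (absMoment α fun s => u n s - f s) ^ β := fun n => by
    simpa using hadd f (fun s => u n s - f s) hf ((hu n).sub hf)
  have h2 : ∀ n, absMoment α f ^ β ≤
      absMoment α (u n) ^ β + (absMoment α fun s => u n s - f s) ^ β := fun n => by
    rw [← absMoment_neg α fun s => u n s - f s]
    simpa using hadd (u n) (fun s => -(u n s - f s)) (hu n) ((hu n).sub hf).neg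
  -- Finiteness for `f` is inherited from one close approximant.
  have hfin' : absMoment α f ^ β ≠ ⊤ := by
    obtain ⟨n, hn⟩ := (h'.eventually (gt_mem_nhds ENNReal.zero_lt_top)).exists
    exact ne_top_of_le_ne_top
      (ENNReal.add_ne_top.2 ⟨ENNReal.rpow_ne_top_of_nonneg hβ.le (hfin n), hn.ne⟩) (h2 n)
  have hlim : Tendsto (fun n => absMoment α (u n) ^ β) atTop (𝓝 (absMoment α f ^ β)) := by
    refine tendsto_of_tendsto_of_tendsto_of_le_of_le
      (g := fun n => absMoment α f ^ β - (absMoment α fun s => u n s - f s) ^ β) ?_ ?_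
      (fun n => tsub_le_iff_right.2 (h2 n)) h1
    · simpa using ENNReal.Tendsto.sub (tendsto_const_nhds (x := absMoment α f ^ β)) h'
        (Or.inl hfin')
    · simpa using (tendsto_const_nhds (x := absMoment α f ^ β)).add h'
  have := (ENNReal.continuous_rpow_const (y := β⁻¹)).continuousAt.tendsto.comp hlim
  simp only [Function.comp_def, ← ENNReal.rpow_mul, mul_inv_cancel₀ hβ.ne',
    ENNReal.rpow_one] at this
  refine (ENNReal.tendsto_toReal fun htop => hfin' ?_).comp this
  rw [htop, ENNReal.top_rpow_of_pos hβ]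

/-- Dominated convergence along an almost surely convergent subsequence, which suffices to identify
a limit. -/
theorem MeasureTheory.TendstoInMeasure.tendsto_charFun {Ω : Type*} [MeasurableSpace Ω]
    {P : Measure Ω} [IsProbabilityMeasure P] {U : ℕ → Ω → ℝ} {Y : Ω → ℝ}
    (hU : ∀ n, AEMeasurable (U n) P) (h : TendstoInMeasure P U atTop Y) (θ : ℝ) :
    ∃ ns : ℕ → ℕ, StrictMono ns ∧
      Tendsto (fun n => charFun (P.map (U (ns n))) θ) atTop (𝓝 (charFun (P.map Y) θ)) := by
  obtain ⟨ns, hns, hae⟩ := h.exists_seq_tendsto_ae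
  refine ⟨ns, hns, ?_⟩
  have hY : AEMeasurable Y P := h.aemeasurable hU
  have hcont : Continuous fun y : ℝ => Complex.exp (θ * y * Complex.I) := by fun_prop
  have e : ∀ {V : Ω → ℝ}, AEMeasurable V P →
      charFun (P.map V) θ = ∫ ω, Complex.exp (θ * V ω * Complex.I) ∂P := fun hV => by
    rw [charFun_apply_real, integral_map hV hcont.aestronglyMeasurable]
  rw [e hY]
  simp_rw [e (hU _)]
  refine tendsto_integral_of_dominated_convergence (fun _ => 1)
    (fun n => (hcont.measurable.comp_aemeasurable (hU _)).aestronglyMeasurable)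
    (integrable_const _) (fun n => ae_of_all _ fun ω => ?_) ?_
  · rw [← Complex.ofReal_mul, Complex.norm_exp_ofReal_mul_I]
  · filter_upwards [hae] with ω hω
    exact (hcont.tendsto _).comp hω

theorem IsStableIntegral.charFun_eq {Ω : Type*} [MeasurableSpace Ω] {P : Measure Ω}
    [IsProbabilityMeasure P] {α : ℝ} (hα : 0 < α) {L : ℝ → Ω → ℝ} (hL : IsSaSLevyMotion α L P)
    {f : ℝ → ℝ} {Y : Ω → ℝ} (h : IsStableIntegral α P L f Y) (θ : ℝ) :
    charFun (P.map Y) θ = ((Real.exp (-((absMoment α f).toReal * |θ| ^ α)) : ℝ) : ℂ) := by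
  obtain ⟨hf, S, hS, hY⟩ := h
  obtain ⟨ns, hns, hlim⟩ := hY.tendsto_charFun (fun n => aemeasurable_stepIntegral hL (S n)) θ
  refine tendsto_nhds_unique hlim ?_
  have hm := (tendsto_toReal_absMoment hα (fun n => measurable_stepFun (S n)) hf
    (fun n => (charFun_stepIntegral hα hL (S n)).1)
    ((tendsto_eLpNorm_iff_absMoment hα _).1 hS)).comp hns.tendsto_atTop
  simp_rw [fun n => (charFun_stepIntegral hα hL (S n)).2 θ]
  have hc : Continuous fun m : ℝ => ((Real.exp (-(m * |θ| ^ α)) : ℝ) : ℂ) := by fun_prop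
  exact (hc.tendsto _).comp hm

theorem MeasureTheory.TendstoInMeasure.sub_real {Ω : Type*} [MeasurableSpace Ω] {P : Measure Ω}
    {U V : ℕ → Ω → ℝ} {Y W : Ω → ℝ} (hU : TendstoInMeasure P U atTop Y)
    (hV : TendstoInMeasure P V atTop W) :
    TendstoInMeasure P (fun n ω => U n ω - V n ω) atTop (fun ω => Y ω - W ω) := by
  rw [tendstoInMeasure_iff_norm] at *
  intro ε hε
  have h := (hU (ε / 2) (by positivity)).add (hV (ε / 2) (by positivity))
  rw [add_zero] at h
  refine tendsto_of_tendsto_of_tendsto_of_le_of_le tendsto_const_nhds h (fun _ => zero_le)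
    fun n => (measure_mono fun ω hω => ?_).trans (measure_union_le _ _)
  simp only [Set.mem_ofPred_eq, Set.mem_union] at hω ⊢
  by_contra! hcon
  have := norm_sub_le (U n ω - Y ω) (V n ω - W ω)
  rw [show U n ω - V n ω - (Y ω - W ω) = U n ω - Y ω - (V n ω - W ω) by ring] at hω
  linarith [hcon.1, hcon.2]

/-- The step function with all coefficients negated. -/
def negStep (S : List StepTerm) : List StepTerm :=
  S.map fun T => { T with coeff := -T.coeff }

theorem stepIntegral_append_negStep {Ω : Type*} (L : ℝ → Ω → ℝ) (S S' : List StepTerm) (ω : Ω) :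
    stepIntegral L (S ++ negStep S') ω = stepIntegral L S ω - stepIntegral L S' ω := by
  have : stepIntegral L (negStep S') ω = -stepIntegral L S' ω := by
    induction S' with
    | nil => simp [stepIntegral, negStep]
    | cons T S' ih =>
      simp only [stepIntegral, negStep, List.map_cons, List.sum_cons] at ih ⊢
      rw [ih]
      ring
  rw [sub_eq_add_neg, ← this]
  simp [stepIntegral]

theorem stepFun_append_negStep (S S' : List StepTerm) (s : ℝ) :
    stepFun (S ++ negStep S') s = stepFun S s - stepFun S' s := by
  simp only [stepFun_eq_stepIntegral, stepIntegral_append_negStep]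

theorem IsStableIntegral.sub {Ω : Type*} [MeasurableSpace Ω] {P : Measure Ω} {α : ℝ} (hα : 0 < α)
    {L : ℝ → Ω → ℝ} {f g : ℝ → ℝ} {Y W : Ω → ℝ} (hY : IsStableIntegral α P L f Y)
    (hW : IsStableIntegral α P L g W) :
    IsStableIntegral α P L (fun s => f s - g s) (fun ω => Y ω - W ω) := by
  obtain ⟨hf, S, hS, hSY⟩ := hY
  obtain ⟨hg, S', hS', hSW⟩ := hW
  refine ⟨hf.sub hg, fun n => S n ++ negStep (S' n), ?_, ?_⟩
  · rw [tendsto_eLpNorm_iff_absMoment hα] at *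
    obtain ⟨β, hβ, hadd⟩ := exists_absMoment_rpow_subadditive hα
    rw [← tendsto_rpow_zero_iff hβ] at *
    have h := hS.add hS'
    rw [add_zero] at h
    refine tendsto_of_tendsto_of_tendsto_of_le_of_le tendsto_const_nhds h (fun _ => zero_le)
      fun n => ?_
    have := hadd (fun s => stepFun (S n) s - f s) (fun s => -(stepFun (S' n) s - g s))
      ((measurable_stepFun _).sub hf) ((measurable_stepFun _).sub hg).neg
    rw [absMoment_neg] at this
    refine le_trans (le_of_eq ?_) this
    congr 2
    funext s
    rw [stepFun_append_negStep]
    ring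
  · have := hSY.sub_real hSW
    simpa only [← stepIntegral_append_negStep] using this

/-- The codifference of two stable integrals in terms of the scales of the integrands. -/
theorem IsStableIntegral.codifference_eq {Ω : Type*} [MeasurableSpace Ω] {P : Measure Ω}
    [IsProbabilityMeasure P] {α : ℝ} (hα : 0 < α) {L : ℝ → Ω → ℝ} (hL : IsSaSLevyMotion α L P)
    {f g : ℝ → ℝ} {Y W : Ω → ℝ} (hY : IsStableIntegral α P L f Y)
    (hW : IsStableIntegral α P L g W) :
    codifference P Y W = (((absMoment α f).toReal + (absMoment α g).toReal -
      (absMoment α fun s => f s - g s).toReal : ℝ) : ℂ) := by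
  unfold codifference
  rw [hY.charFun_eq hα hL, hW.charFun_eq hα hL, (hY.sub hα hW).charFun_eq hα hL]
  -- The characteristic functions are positive reals, so the principal logarithm is the real one.
  simp only [← Complex.ofReal_log (Real.exp_pos _).le, Real.log_exp, abs_neg, abs_one,
    Real.one_rpow, mul_one]
  push_cast
  ring

/-! ### Scaling and translation of the kernel -/

theorem posPartPow_mul {h : ℝ} (hh : 0 < h) (x a : ℝ) :
    posPartPow (h * x) a = h ^ a * posPartPow x a := by
  unfold posPartPow
  by_cases hx : 0 < x
  · rw [if_pos (by positivity), if_pos hx, Real.mul_rpow hh.le hx.le]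
  · rw [if_neg (by rwa [mul_pos_iff_of_pos_left hh]), if_neg hx, mul_zero]

theorem measurable_posPartPow (a : ℝ) : Measurable fun x => posPartPow x a :=
  Measurable.ite (measurableSet_lt measurable_const measurable_id)
    (measurable_id.pow_const a) measurable_const

theorem measurable_lfsmKernel (α H t : ℝ) : Measurable (lfsmKernel α H t) :=
  ((measurable_posPartPow _).comp (measurable_const.sub measurable_id)).sub
    ((measurable_posPartPow _).comp measurable_neg)

theorem toReal_absMoment {α : ℝ} (hα : 0 < α) {f : ℝ → ℝ} (hf : Measurable f) :
    (absMoment α f).toReal = ∫ s, |f s| ^ α := by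
  rw [integral_eq_lintegral_of_nonneg_ae (ae_of_all _ fun s => by positivity)
    (by exact (hf.abs.pow_const α).aestronglyMeasurable)]
  congr 1
  refine lintegral_congr fun s => ?_
  rw [Real.enorm_eq_ofReal_abs, ENNReal.ofReal_rpow_of_nonneg (abs_nonneg _) hα.le]

/-- Substituting `s ↦ h * s`, homogeneity of degree `H - 1/α` contributes `h^(αH - 1)` and the
Jacobian one more `h`. -/
theorem integral_abs_lfsmKernel_rpow_of_pos {α H : ℝ} (hα : 0 < α) {h : ℝ} (hh : 0 < h) :
    ∫ s, |lfsmKernel α H h s| ^ α = h ^ (α * H) * ∫ s, |lfsmKernel α H 1 s| ^ α := by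
  have e : ∀ s, |lfsmKernel α H h (h * s)| ^ α =
      h ^ (α * H - 1) * |lfsmKernel α H 1 s| ^ α := fun s => by
    unfold lfsmKernel
    rw [show h - h * s = h * (1 - s) by ring, show -(h * s) = h * -s by ring,
      posPartPow_mul hh, posPartPow_mul hh, ← mul_sub, abs_mul,
      Real.mul_rpow (abs_nonneg _) (abs_nonneg _), abs_of_pos (by positivity),
      ← Real.rpow_mul hh.le]
    congr 2
    field_simp
  have h1 := Measure.integral_comp_mul_left (fun s => |lfsmKernel α H h s| ^ α) h
  simp_rw [e, integral_const_mul, smul_eq_mul, abs_of_pos (inv_pos.2 hh)] at h1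
  rw [Real.rpow_sub_one hh.ne'] at h1
  field_simp at h1
  linarith

theorem integral_abs_lfsmKernel_sub_rpow {α H : ℝ} (hα : 0 < α) (hH : 0 < H) (t s : ℝ) :
    ∫ u, |lfsmKernel α H t u - lfsmKernel α H s u| ^ α =
      |t - s| ^ (α * H) * ∫ u, |lfsmKernel α H 1 u| ^ α := by
  wlog hst : s ≤ t generalizing s t
  · have := this s t (le_of_not_ge hst)
    rw [abs_sub_comm, ← this]
    simp_rw [abs_sub_comm]
  have e : ∀ u, lfsmKernel α H t (u + s) - lfsmKernel α H s (u + s) =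
      lfsmKernel α H (t - s) u := fun u => by
    unfold lfsmKernel
    rw [show t - (u + s) = t - s - u by ring, show s - (u + s) = -u by ring]
    ring
  rw [← integral_add_right_eq_self (μ := volume)
    (fun u => |lfsmKernel α H t u - lfsmKernel α H s u| ^ α) s]
  simp_rw [e]
  obtain rfl | hlt := hst.eq_or_lt
  · have : ∀ u, lfsmKernel α H 0 u = 0 := fun u => by simp [lfsmKernel]
    simp [this, hα.ne', hH.ne']
  · rw [integral_abs_lfsmKernel_rpow_of_pos hα (sub_pos.2 hlt), abs_of_pos (sub_pos.2 hlt)]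

theorem lfsmScale_rpow {α : ℝ} (hα : 0 < α) (H : ℝ) :
    lfsmScale α H ^ α = ∫ u, |lfsmKernel α H 1 u| ^ α := by
  unfold lfsmScale
  rw [← Real.rpow_mul (integral_nonneg fun u => by positivity), one_div_mul_cancel hα.ne',
    Real.rpow_one]

theorem IsLFSM.codifference_eq {Ω : Type*} [MeasurableSpace Ω] {P : Measure Ω}
    [IsProbabilityMeasure P] {α H : ℝ} (hα : 0 < α) (hH : 0 < H) {X : ℝ → Ω → ℝ}
    (hX : IsLFSM α H P X) (t s : ℝ) :
    codifference P (X t) (X s) = ((lfsmScale α H ^ α *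
      (|t| ^ (α * H) + |s| ^ (α * H) - |t - s| ^ (α * H)) : ℝ) : ℂ) := by
  obtain ⟨L, hL, hX⟩ := hX
  have hm := measurable_lfsmKernel α H
  have e : ∀ t, (absMoment α (lfsmKernel α H t)).toReal =
      |t| ^ (α * H) * ∫ u, |lfsmKernel α H 1 u| ^ α := fun t => by
    have := integral_abs_lfsmKernel_sub_rpow hα hH t 0
    simpa [toReal_absMoment hα (hm t), show ∀ u, lfsmKernel α H 0 u = 0 from
      fun u => by simp [lfsmKernel]] using this
  rw [(hX t).codifference_eq hα hL (hX s), e, e,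
    toReal_absMoment hα (f := fun u => lfsmKernel α H t u - lfsmKernel α H s u) ((hm t).sub (hm s)),
    integral_abs_lfsmKernel_sub_rpow hα hH, lfsmScale_rpow hα]
  congr 1
  ring

/-- The exponent is `0`, so the kernel is the indicator of `[0, 1)`. -/
theorem lfsmScale_rpow_of_eq_one_div {α : ℝ} (hα : 0 < α) :
    lfsmScale α (1 / α) ^ α = 1 := by
  rw [lfsmScale_rpow hα]
  have : (fun u => |lfsmKernel α (1 / α) 1 u| ^ α) =
      (Set.Ico (0 : ℝ) 1).indicator fun _ => (1 : ℝ) := by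
    funext u
    unfold lfsmKernel posPartPow
    by_cases h0 : u < 0
    · have : u < 1 := by linarith
      simp [h0, this, hα.ne', not_le.2 h0]
    · by_cases h1 : u < 1 <;> simp [h0, h1, hα.ne', not_lt.1 h0]
  rw [this, integral_indicator_const _ measurableSet_Ico]
  simp

/-! ### From equal codifferences to the system -/

theorem Fin.sum_univ_eq_add_sum_Iio {d : ℕ} {f : Fin d → ℝ} {i : Fin d}
    (h : ∀ j, i < j → f j = 0) : ∑ j, f j = f i + ∑ j ∈ Finset.Iio i, f j := by
  rw [← Finset.sum_insert (by simp)]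
  refine (Finset.sum_subset (Finset.subset_univ _) fun j _ hj => h j ?_).symm
  simp only [Finset.mem_insert, Finset.mem_Iio, not_or, not_lt] at hj
  exact lt_of_le_of_ne hj.2 (Ne.symm hj.1)

theorem lowerCombination_eq_sum_univ {Ω : Type*} {d : ℕ} {a : Fin d → Fin d → ℝ}
    (ha : ∀ i j, i < j → a i j = 0) (Z : Fin d → Ω → ℝ) (i : Fin d) :
    lowerCombination a Z i = fun ω => ∑ j, a i j * Z j ω := by
  funext ω
  refine Finset.sum_subset (Finset.subset_univ _) fun j _ hj => ?_
  rw [ha i j (by simpa using hj), zero_mul]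

theorem codifference_lowerCombination {Ω : Type*} [MeasurableSpace Ω] {P : Measure Ω} {α : ℝ}
    {d : ℕ} {Z : Fin d → Ω → ℝ} (hZ : ∀ j, IsSaS α 1 (Z j) P) (hind : iIndepFun Z P)
    {a : Fin d → Fin d → ℝ} (ha : ∀ i j, i < j → a i j = 0) (i i' : Fin d) :
    codifference P (lowerCombination a Z i) (lowerCombination a Z i') =
      ((∑ j, (|a i j| ^ α + |a i' j| ^ α - |a i j - a i' j| ^ α) : ℝ) : ℂ) := by
  unfold codifference
  have e : (fun ω => lowerCombination a Z i ω - lowerCombination a Z i' ω) =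
      fun ω => ∑ j, (a i j - a i' j) * Z j ω := by
    funext ω
    simp only [lowerCombination_eq_sum_univ ha, ← Finset.sum_sub_distrib, sub_mul]
  rw [e, lowerCombination_eq_sum_univ ha, lowerCombination_eq_sum_univ ha,
    charFun_sum_mul hZ hind, charFun_sum_mul hZ hind, charFun_sum_mul hZ hind]
  simp only [← Complex.ofReal_log (Real.exp_pos _).le, Real.log_exp, abs_neg, abs_one,
    Real.one_rpow, mul_one, Finset.sum_add_distrib, Finset.sum_sub_distrib]
  push_cast
  ring

theorem IsCodiffDecomposition.solvesSystem {Ω Ω' : Type*} [MeasurableSpace Ω]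
    [MeasurableSpace Ω'] {P : Measure Ω} [IsProbabilityMeasure P] {P' : Measure Ω'}
    {α H : ℝ} (hα : 0 < α) (hH : 0 < H) {X : ℝ → Ω → ℝ} (hX : IsLFSM α H P X) {t d : ℕ}
    {Z : Fin d → Ω' → ℝ} {a : Fin d → Fin d → ℝ}
    (h : IsCodiffDecomposition α P X t d P' Z a) : SolvesSystem α H t a := by
  have hne : α * H ≠ 0 := (mul_pos hα hH).ne'
  have key : ∀ i i' : Fin d, ∑ j, (|a i j| ^ α + |a i' j| ^ α - |a i j - a i' j| ^ α) =
      lfsmScale α H ^ α * (|(t : ℝ) + (i : ℕ)| ^ (α * H) + |(t : ℝ) + (i' : ℕ)| ^ (α * H) -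
        |((i : ℕ) : ℝ) - (i' : ℕ)| ^ (α * H)) := fun i i' => by
    have := h.codiff_eq i i'
    rw [codifference_lowerCombination h.stable h.indep h.lower, hX.codifference_eq hα hH,
      Complex.ofReal_inj, add_sub_add_left_eq_sub] at this
    exact this
  have hdiag : ∀ i : Fin d, ∑ j, |a i j| ^ α =
      lfsmScale α H ^ α * |(t : ℝ) + (i : ℕ)| ^ (α * H) := fun i => by
    have := key i i
    simp only [sub_self, abs_zero, Real.zero_rpow hα.ne', Real.zero_rpow hne, sub_zero,
      Finset.sum_add_distrib] at this
    linarith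
  constructor
  · intro i
    rw [← hdiag i, Fin.sum_univ_eq_add_sum_Iio (i := i) fun j hj => by
      rw [h.lower i j hj, abs_zero, Real.zero_rpow hα.ne']]
    ring
  · intro i i' _
    have h1 := key i' i
    have h2 := hdiag i
    -- The codifference of rows `i'` and `i`, minus the diagonal identity for row `i`.
    have h3 : ∑ j, (|a i' j| ^ α - |a i' j - a i j| ^ α) =
        lfsmScale α H ^ α * (|(t : ℝ) + (i' : ℕ)| ^ (α * H) -
          |((i' : ℕ) : ℝ) - (i : ℕ)| ^ (α * H)) := by
      simp only [Finset.sum_add_distrib, Finset.sum_sub_distrib] at h1 ⊢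
      linarith
    rw [← h3, Fin.sum_univ_eq_add_sum_Iio (i := i) fun j hj => by
      rw [h.lower i j hj, sub_zero, sub_self]]
    unfold offDiagFun
    ring

/-! ### Uniqueness of admissible solutions -/

/-- For `z < w`, both `z` and `w - c` lie strictly between `z - c` and `w` and have the same sum.
They are convex combinations of these with swapped weights, so adding the two strict convexity
inequalities gives the claim. -/
theorem strictMonoOn_rpow_sub_abs_rpow_Ioi {α c : ℝ} (hα : 1 < α) (hc : 0 < c) :
    StrictMonoOn (fun z : ℝ => |z| ^ α - |z - c| ^ α) (Set.Ioi c) := by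
  intro z hz w hw hzw
  simp only [Set.mem_Ioi] at hz hw
  have hconv := strictConvexOn_rpow hα
  have hD : 0 < w - z + c := by linarith
  have hp : 0 < (w - z) / (w - z + c) := div_pos (by linarith) hD
  have hq : 0 < c / (w - z + c) := div_pos hc hD
  have hpq : (w - z) / (w - z + c) + c / (w - z + c) = 1 := by
    rw [← add_div, div_self hD.ne']
  have m1 : z - c ∈ Set.Ici (0 : ℝ) := Set.mem_Ici.2 (by linarith)
  have m2 : w ∈ Set.Ici (0 : ℝ) := Set.mem_Ici.2 (by linarith)
  have h1 := hconv.2 m1 m2 (by linarith) hp hq hpq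
  have h2 := hconv.2 m1 m2 (by linarith) hq hp (by linarith)
  simp only [smul_eq_mul] at h1 h2
  rw [show (w - z) / (w - z + c) * (z - c) + c / (w - z + c) * w = z by field_simp; ring] at h1
  rw [show c / (w - z + c) * (z - c) + (w - z) / (w - z + c) * w = w - c by
    field_simp; ring] at h2
  have h3 : ∀ y : ℝ, (w - z) / (w - z + c) * y + c / (w - z + c) * y = y := fun y => by
    rw [← add_mul, hpq, one_mul]
  simp only
  rw [abs_of_pos (hc.trans hz), abs_of_pos (hc.trans hw), abs_of_pos (sub_pos.2 hz),
    abs_of_pos (sub_pos.2 hw)]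
  linarith [h3 ((z - c) ^ α), h3 (w ^ α)]

/-- Here `z^α` increases and `(c - z)^α` decreases, so no convexity is needed. -/
theorem strictMonoOn_rpow_sub_abs_rpow_Ioo {α : ℝ} (hα : 0 < α) (c : ℝ) :
    StrictMonoOn (fun z : ℝ => |z| ^ α - |z - c| ^ α) (Set.Ioo 0 c) := by
  intro z hz w hw hzw
  simp only
  rw [abs_of_pos hz.1, abs_of_pos hw.1, abs_sub_comm z, abs_sub_comm w,
    abs_of_pos (sub_pos.2 hz.2), abs_of_pos (sub_pos.2 hw.2)]
  exact sub_lt_sub (Real.rpow_lt_rpow hz.1.le hzw hα)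
    (Real.rpow_lt_rpow (sub_pos.2 hw.2).le (by linarith) hα)

theorem SolvesSystem.unique {α H : ℝ} (hα : 0 < α) (hH1 : H < 1) {t d : ℕ}
    {a b : Fin d → Fin d → ℝ} (ha0 : ∀ i j, i < j → a i j = 0)
    (hb0 : ∀ i j, i < j → b i j = 0) (ha : IsAdmissible α H a) (hb : IsAdmissible α H b)
    (has : SolvesSystem α H t a) (hbs : SolvesSystem α H t b) : b = a := by
  suffices h : ∀ (n : ℕ) (j : Fin d), (j : ℕ) = n → ∀ i, b i j = a i j from
    funext fun i => funext fun j => h j j rfl i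
  intro n
  induction n using Nat.strong_induction_on with
  | _ n ih =>
  rintro j rfl
  have ih' : ∀ k ∈ Finset.Iio j, ∀ i, b i k = a i k := fun k hk i =>
    ih k (by simpa using hk) k rfl i
  have hjj : b j j = a j j := by
    have h : |b j j| ^ α = |a j j| ^ α := by
      rw [has.diag, hbs.diag, Finset.sum_congr rfl fun k hk => by rw [ih' k hk j]]
    rw [abs_of_pos (ha.pos j j le_rfl), abs_of_pos (hb.pos j j le_rfl)] at h
    exact (Real.rpow_left_inj (hb.pos j j le_rfl).le (ha.pos j j le_rfl).le hα.ne').1 h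
  intro i
  rcases lt_trichotomy i j with hij | rfl | hij
  · rw [ha0 i j hij, hb0 i j hij]
  · exact hjj
  have h : |b i j| ^ α - |b i j - a j j| ^ α = |a i j| ^ α - |a i j - a j j| ^ α := by
    have h1 := has.offDiag j i hij
    have h2 := hbs.offDiag j i hij
    unfold offDiagFun at h1 h2
    rw [hjj, Finset.sum_congr rfl fun k hk => by rw [ih' k hk i, ih' k hk j], ← h1] at h2
    exact h2
  rcases lt_trichotomy H (1 / α) with hH | hH | hH
  · refine (strictMonoOn_rpow_sub_abs_rpow_Ioo hα (a j j)).injOn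
      ⟨hb.pos i j hij.le, ?_⟩ ⟨ha.pos i j hij.le, ha.decreasing hH j j i le_rfl hij⟩ h
    rw [← hjj]
    exact hb.decreasing hH j j i le_rfl hij
  · rw [ha.constant hH j j i le_rfl hij, hb.constant hH j j i le_rfl hij, hjj]
  · have hα1 : 1 < α := by
      have := hH.trans hH1
      rwa [div_lt_one hα] at this
    refine (strictMonoOn_rpow_sub_abs_rpow_Ioi hα1 (ha.pos j j le_rfl)).injOn ?_
      (ha.increasing hH j j i le_rfl hij) h
    rw [← hjj]
    exact hb.increasing hH j j i le_rfl hij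

/-! ### Closed form for `H = 1/α` -/

theorem SolvesSystem.eq_of_eq_one_div {α : ℝ} (hα : 0 < α) {t d : ℕ}
    {a : Fin d → Fin d → ℝ} (ha0 : ∀ i j, i < j → a i j = 0)
    (ha : IsAdmissible α (1 / α) a) (hs : SolvesSystem α (1 / α) t a) (i j : Fin d) :
    a i j = if j ≤ i then (if (j : ℕ) = 0 then (t : ℝ) ^ (1 / α) else 1) else 0 := by
  split_ifs with hji hj0
  all_goals try exact ha0 i j (not_le.1 hji)
  all_goals
    have hcol : ∀ i j, j ≤ i → a i j = a j j := fun i j hji => by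
      rcases hji.eq_or_lt with rfl | h
      · rfl
      · exact ha.constant rfl j j i le_rfl h
    -- With `K^α = 1`, `αH = 1` and constant columns, the diagonal entries satisfy `∑_{k ≤ i} a_kk^α
    -- = t + i`.
    have hsum : ∀ i : Fin d, |a i i| ^ α + ∑ k ∈ Finset.Iio i, |a k k| ^ α =
        (t : ℝ) + (i : ℕ) := fun i => by
      rw [hs.diag i, lfsmScale_rpow_of_eq_one_div hα, mul_one_div_cancel hα.ne', Real.rpow_one,
        abs_of_nonneg (by positivity), one_mul]
      rw [Finset.sum_congr rfl fun k hk => by rw [hcol i k (Finset.mem_Iio.1 hk).le]]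
      ring
    have hpos : ∀ j, 0 < a j j := fun j => ha.pos j j le_rfl
    rw [hcol i j hji]
    have hj := hsum j
  · rw [Finset.sum_eq_zero fun k hk => absurd (Finset.mem_Iio.1 hk)
        (by simp [Fin.lt_def, hj0]), hj0, abs_of_pos (hpos j)] at hj
    simp only [add_zero, Nat.cast_zero] at hj
    rw [← hj, ← Real.rpow_mul (hpos j).le, mul_one_div_cancel hα.ne', Real.rpow_one]
  -- For `j > 0`, subtracting the identity at `j - 1` from that at `j` leaves `a_jj^α = 1`.
  · have hlt : (j : ℕ) - 1 < d := by omega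
    have hk := hsum ⟨(j : ℕ) - 1, hlt⟩
    have hset : Finset.Iio j = insert (⟨(j : ℕ) - 1, hlt⟩ : Fin d)
        (Finset.Iio ⟨(j : ℕ) - 1, hlt⟩) := by
      ext k
      simp only [Finset.mem_Iio, Finset.mem_insert, Fin.lt_def, Fin.ext_iff]
      omega
    rw [hset, Finset.sum_insert (by simp), hk, abs_of_pos (hpos j)] at hj
    simp only at hj
    rw [Nat.cast_sub (Nat.one_le_iff_ne_zero.2 hj0), Nat.cast_one] at hj
    have h1 : a j j ^ α = 1 ^ α := by
      rw [Real.one_rpow]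
      linarith
    exact (Real.rpow_left_inj (hpos j).le zero_le_one hα.ne').1 h1

theorem theorem1 {Ω : Type*} [MeasurableSpace Ω] (P : Measure Ω) [IsProbabilityMeasure P]
    (α H : ℝ) (hα0 : 0 < α) (hα2 : α ≤ 2) (hH0 : 0 < H) (hH1 : H < 1)
    (X : ℝ → Ω → ℝ) (hX : IsLFSM α H P X) (t d : ℕ) (hd : 1 ≤ d)
    {Ω₁ : Type*} [MeasurableSpace Ω₁] (P₁ : Measure Ω₁) [IsProbabilityMeasure P₁]
    (Z : Fin d → Ω₁ → ℝ) (a : Fin d → Fin d → ℝ)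
    (hdec : IsCodiffDecomposition α P X t d P₁ Z a) (hadm : IsAdmissible α H a) :
    -- the coefficients solve the system
    SolvesSystem α H t a ∧
    -- they are its only admissible lower-triangular solution
    (∀ b : Fin d → Fin d → ℝ, (∀ i j, i < j → b i j = 0) → IsAdmissible α H b →
      SolvesSystem α H t b → b = a) ∧
    -- every other admissible decomposition has the same coefficients
    (∀ {Ω₂ : Type*} [MeasurableSpace Ω₂] (P₂ : Measure Ω₂) [IsProbabilityMeasure P₂]
      (W : Fin d → Ω₂ → ℝ) (b : Fin d → Fin d → ℝ),
      IsCodiffDecomposition α P X t d P₂ W b → IsAdmissible α H b → b = a) ∧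
    -- closed form
    (H = 1 / α → ∀ i j : Fin d,
      a i j = if j ≤ i then (if (j : ℕ) = 0 then (t : ℝ) ^ (1 / α) else 1) else 0) := by
  have has := hdec.solvesSystem hα0 hH0 hX
  have huniq : ∀ b : Fin d → Fin d → ℝ, (∀ i j, i < j → b i j = 0) → IsAdmissible α H b →
      SolvesSystem α H t b → b = a := fun b hb0 hb hbs =>
    SolvesSystem.unique hα0 hH1 hdec.lower hb0 hadm hb has hbs
  refine ⟨has, huniq, fun P₂ _ W b hb hba =>
    huniq b hb.lower hba (hb.solvesSystem hα0 hH0 hX), ?_⟩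
  rintro rfl i j
  exact has.eq_of_eq_one_div hα0 hdec.lower hadm i j
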